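/- Let $G$ be a finite connected simple graph on $n$ vertices. A block of $G$ is a maximal connected subgraph having no cut vertex of its own. The block tree $T$ of $G$ has as its vertices the cut vertices and the blocks of $G$, a cut vertex $v$ being adjacent to a block $B$ exactly when $v\in B$ (and no other pairs being adjacent). It is weighted by $w(v)=1$ for a cut vertex $v$, and by letting $w(B)$ be the number of vertices of $B$ that are not cut vertices of $G$, for a block $B$; the weight of a set of vertices (or of a subtree) is the sum of the weights of its vertices. For a vertex $x$ of $T$ let $\mathrm{hs}(x)$ be the maximum weight of a connected component of $T-x$ (and $0$ if $x$ is the only vertex of $T$). A centroid of $T$ is a vertex minimizing $\mathrm{hs}$; a central centroid is a center (vertex of minimum eccentricity) of the path formed by the centroids of $T$. Then exactly one of the following holds. 1. $T$ has exactly one centroid $c$, and $\mathrm{hs}(c)<\frac n2$. 2. $T$ has exactly two centroids $v$ and $B$, where $B$ is a block of $G$ and $v\in B$ is a cut vertex of $G$, and the removal of the edge $vB$ partitions $T$ into two subtrees $T_1,T_2$ of weight $\frac n2$ each. Moreover, every proper subtree of $T_1$ and every proper subtree of $T_2$ has weight at most $\frac n2-1$. 3. $T$ contains a block vertex $B$ of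 weight zero which is the unique central centroid of $T$ and whose removal partitions $T$ into exactly two subtrees, each of weight $\frac n2$; moreover the block $B$ is a $K_2$. -/

import Mathlib

namespace BlockTree

section WeightedTree

variable {W : Type*}

/-- The weight `w(U)` of a set `U` of vertices (all vertex types used here are finite). -/
noncomputable def setWeight (w : W → ℕ) (U : Set W) : ℕ := ∑ᶠ x ∈ U, w x

/-- The vertex set, as a set of vertices of `T`, of a connected component of `T - v`,
i.e. of a subtree of `v` in the tree `T`. -/
def subtreeVerts (T : SimpleGraph W) (v : W)
    (C : (T.induce ({v}ᶜ : Set W)).ConnectedComponent) : Set W :=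
  Subtype.val '' C.supp

/-- The heaviest subtree weight of `v` in `(T, w)`; it is `0` if `v` is the only vertex. -/
noncomputable def hs (T : SimpleGraph W) (w : W → ℕ) (v : W) : ℕ :=
  ⨆ C : (T.induce ({v}ᶜ : Set W)).ConnectedComponent, setWeight w (subtreeVerts T v C)

/-- The set of centroids of `(T, w)`: the vertices of minimum heaviest subtree weight. -/
def centroids (T : SimpleGraph W) (w : W → ℕ) : Set W :=
  {c | ∀ x, hs T w c ≤ hs T w x}

/-- `c` is a central centroid: the centroids are exactly the vertices of a path `P` of `T`,
and `c` is a center (vertex of minimum eccentricity) of the path graph `P`. -/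
def IsCentralCentroid (T : SimpleGraph W) (w : W → ℕ) (c : W) : Prop :=
  ∃ (a b : W) (P : T.Walk a b), P.IsPath ∧ P.toSubgraph.verts = centroids T w ∧
    ∃ h : c ∈ P.toSubgraph.verts, (⟨c, h⟩ : P.toSubgraph.verts) ∈ P.toSubgraph.coe.center

/-- Every proper subtree of the part of the tree `T` with vertex set `U` has weight at most `r`.
Subtrees of a tree are its nonempty connected induced subgraphs. -/
def ProperSubtreesWeighAtMost (T : SimpleGraph W) (w : W → ℕ) (U : Set W) (r : ℚ) : Prop :=
  ∀ S : Set W, S ⊂ U → (T.induce S).Connected → (setWeight w S : ℚ) ≤ r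

/-- The removal of the edge `xy` partitions `T` into exactly two components, the one of `x` and
the one of `y`; each has weight `n/2`, and their proper subtrees weigh at most `n/2 - 1`. -/
def EdgeHalves (T : SimpleGraph W) (w : W → ℕ) (n : ℕ) (x y : W) : Prop :=
  ∃ C₁ C₂ : (T.deleteEdges {s(x, y)}).ConnectedComponent,
    x ∈ C₁.supp ∧ y ∈ C₂.supp ∧ C₁ ≠ C₂ ∧ (∀ C, C = C₁ ∨ C = C₂) ∧
    (setWeight w C₁.supp : ℚ) = n / 2 ∧ (setWeight w C₂.supp : ℚ) = n / 2 ∧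
    ProperSubtreesWeighAtMost T w C₁.supp ((n : ℚ) / 2 - 1) ∧
    ProperSubtreesWeighAtMost T w C₂.supp ((n : ℚ) / 2 - 1)

/-- The removal of the vertex `x` partitions `T` into exactly two subtrees of weight `n/2`. -/
def VertexHalves (T : SimpleGraph W) (w : W → ℕ) (n : ℕ) (x : W) : Prop :=
  ∃ C₁ C₂ : (T.induce ({x}ᶜ : Set W)).ConnectedComponent,
    C₁ ≠ C₂ ∧ (∀ C, C = C₁ ∨ C = C₂) ∧
    (setWeight w (subtreeVerts T x C₁) : ℚ) = n / 2 ∧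
    (setWeight w (subtreeVerts T x C₂) : ℚ) = n / 2

end WeightedTree

section Blocks

variable {V : Type*}

/-- `v` is a cut vertex of `G`: it separates two other vertices of the same component. -/
def IsCutVertex (G : SimpleGraph V) (v : V) : Prop :=
  ∃ a b : ({v}ᶜ : Set V), G.Reachable a.1 b.1 ∧ ¬ (G.induce ({v}ᶜ : Set V)).Reachable a b

/-- `B` is the vertex set of a block of `G`: a maximal connected subgraph without a cut vertex of
its own. Such a subgraph is induced, so that it is determined by its vertex set. -/
def IsBlock (G : SimpleGraph V) (B : Set V) : Prop :=
  Maximal (fun S : Set V => (G.induce S).Connected ∧ ∀ x : S, ¬ IsCutVertex (G.induce S) x) B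

/-- The vertices of the block tree: the cut vertices and the blocks of `G`. -/
abbrev Node (G : SimpleGraph V) : Type _ :=
  {v : V // IsCutVertex G v} ⊕ {B : Set V // IsBlock G B}

/-- Adjacency in the block tree: a cut vertex and a block that contains it. -/
def nodeAdj (G : SimpleGraph V) : Node G → Node G → Prop
  | .inl v, .inr B => v.1 ∈ B.1
  | .inr B, .inl v => v.1 ∈ B.1
  | .inl _, .inl _ => False
  | .inr _, .inr _ => False

/-- The block tree of `G`. -/
def blockTree (G : SimpleGraph V) : SimpleGraph (Node G) where
  Adj := nodeAdj G
  symm := ⟨by rintro (_ | _) (_ | _) h <;> exact h⟩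
  loopless := ⟨by rintro (_ | _) h <;> exact h⟩

/-- The weights of the block tree: a cut vertex weighs `1`, a block weighs the number of its
vertices that are not cut vertices of `G`. -/
noncomputable def weight (G : SimpleGraph V) : Node G → ℕ
  | .inl _ => 1
  | .inr B => {x : V | x ∈ B.1 ∧ ¬ IsCutVertex G x}.ncard

/-- There is exactly one centroid, and its heaviest subtree weight is less than `n/2`. -/
def OneCentroid (G : SimpleGraph V) (n : ℕ) : Prop :=
  ∃ c : Node G, centroids (blockTree G) (weight G) = {c} ∧
    (hs (blockTree G) (weight G) c : ℚ) < n / 2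

/-- There are exactly two centroids, a cut vertex `v` and a block `B` with `v ∈ B`, and the edge
`vB` splits the block tree into two halves. -/
def TwoCentroids (G : SimpleGraph V) (n : ℕ) : Prop :=
  ∃ (v : {v : V // IsCutVertex G v}) (B : {B : Set V // IsBlock G B}), v.1 ∈ B.1 ∧
    centroids (blockTree G) (weight G) = {.inl v, .inr B} ∧
    EdgeHalves (blockTree G) (weight G) n (.inl v) (.inr B)

/-- A block `B` of weight zero is the unique central centroid, its removal splits the block tree
into two halves, and `B` is a `K₂`. -/
def ZeroWeightCentralBlock (G : SimpleGraph V) (n : ℕ) : Prop :=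
  ∃ B : {B : Set V // IsBlock G B}, weight G (.inr B) = 0 ∧
    (∀ x : Node G, IsCentralCentroid (blockTree G) (weight G) x ↔ x = .inr B) ∧
    VertexHalves (blockTree G) (weight G) n (.inr B) ∧
    Nonempty (G.induce B.1 ≃g (⊤ : SimpleGraph (Fin 2)))

end Blocks

end BlockTree

/-!
Some vertex `c` of the block tree `T` satisfies `2 * hs c ≤ n`: otherwise, moving from each vertex
into its branch heavier than `n / 2`, one would eventually turn back along an edge of the finite
tree `T`, and the two sides of that edge would weigh more than `n` together. If the inequality
is strict, then `c` is the only centroid. Otherwise some edge at `c` halves the weight, and all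
ends of halving edges are centroids.

Let `xy` be a halving edge. A centroid beyond `y` forces a second halving edge at `y`, and then `y`
and everything outside the two halves weighs zero. In a block tree, a vertex of weight zero is a
block all of whose vertices are cut vertices of `G`, so that its neighbours in `T` have weight one.
Therefore either `x` and `y` are the only centroids, or there is a block in the middle of two
halving edges, with nothing beside the two halves: it has exactly two vertices and is the middle
one of exactly three centroids. The number of centroids tells the three cases apart.
-/

namespace BlockTree

section Reachability

variable {V : Type*} {G : SimpleGraph V} {S S' : Set V} {a b c u v x y : V}

/-- `ReachableIn G S a b` says that some walk of `G` from `a` to `b` stays inside `S`. It is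
reachability in `G.induce S`, without the coercions to the subtype of `S`. -/
def ReachableIn (G : SimpleGraph V) (S : Set V) (a b : V) : Prop :=
  ∃ p : G.Walk a b, ∀ z ∈ p.support, z ∈ S

theorem ReachableIn.refl (h : a ∈ S) : ReachableIn G S a a :=
  ⟨.nil, by simpa using h⟩

theorem ReachableIn.symm (h : ReachableIn G S a b) : ReachableIn G S b a := by
  obtain ⟨p, hp⟩ := h
  exact ⟨p.reverse, by simpa using hp⟩

theorem ReachableIn.trans (h : ReachableIn G S a b) (h' : ReachableIn G S b c) :
    ReachableIn G S a c := by
  obtain ⟨p, hp⟩ := h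
  obtain ⟨q, hq⟩ := h'
  refine ⟨p.append q, fun z hz => ?_⟩
  rw [SimpleGraph.Walk.mem_support_append_iff] at hz
  exact hz.elim (hp z) (hq z)

theorem ReachableIn.mono (hS : S ⊆ S') (h : ReachableIn G S a b) : ReachableIn G S' a b := by
  obtain ⟨p, hp⟩ := h
  exact ⟨p, fun z hz => hS (hp z hz)⟩

theorem ReachableIn.right_mem (h : ReachableIn G S a b) : b ∈ S := by
  obtain ⟨p, hp⟩ := h
  exact hp _ p.end_mem_support

theorem ReachableIn.of_adj (h : G.Adj a b) (ha : a ∈ S) (hb : b ∈ S) : ReachableIn G S a b :=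
  ⟨h.toWalk, by simp [ha, hb]⟩

theorem reachableIn_iff_reachable_induce (ha : a ∈ S) (hb : b ∈ S) :
    ReachableIn G S a b ↔ (G.induce S).Reachable ⟨a, ha⟩ ⟨b, hb⟩ := by
  constructor
  · rintro ⟨p, hp⟩
    exact ⟨p.induce S hp⟩
  · rintro ⟨p⟩
    exact ⟨p.map (SimpleGraph.Embedding.induce S).toHom, fun z hz => by
      obtain ⟨y, -, rfl⟩ := List.mem_map.1 ((SimpleGraph.Walk.support_map _ p) ▸ hz)
      exact y.2⟩

theorem preconnected_induce_iff :
    (G.induce S).Preconnected ↔ ∀ a ∈ S, ∀ b ∈ S, ReachableIn G S a b :=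
  ⟨fun h a ha b hb => (reachableIn_iff_reachable_induce ha hb).2 (h ⟨a, ha⟩ ⟨b, hb⟩),
    fun h a b => (reachableIn_iff_reachable_induce a.2 b.2).1 (h a a.2 b b.2)⟩

theorem preconnected_induce_of_subset (hS : (G.induce S).Preconnected) (hsub : S ⊆ S')
    (h : ∀ y ∈ S', ∃ s ∈ S, ReachableIn G S' y s) : (G.induce S').Preconnected := by
  refine preconnected_induce_iff.2 fun a ha b hb => ?_
  obtain ⟨s, hs, has⟩ := h a ha
  obtain ⟨t, ht, hbt⟩ := h b hb
  exact (has.trans ((preconnected_induce_iff.1 hS s hs t ht).mono hsub)).trans hbt.symm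

theorem exists_mem_adj_of_preconnected_induce (hS : (G.induce S).Preconnected)
    (ha : a ∈ S) (hb : b ∈ S) (hab : a ≠ b) : ∃ c ∈ S, G.Adj a c := by
  have : Nontrivial S := ⟨⟨a, ha⟩, ⟨b, hb⟩, fun h => hab (congrArg Subtype.val h)⟩
  obtain ⟨c, hc⟩ := hS.exists_adj_of_nontrivial ⟨a, ha⟩
  exact ⟨c, c.2, hc⟩

theorem reachableIn_start_or_end_of_isPath {p : G.Walk a b} (hp : p.IsPath) (hy : y ∈ p.support)
    (hyx : y ≠ x) :
    ReachableIn G ({z | z ∈ p.support} \ {x}) y a ∨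
      ReachableIn G ({z | z ∈ p.support} \ {x}) y b := by
  classical
  by_cases hx : x ∈ (p.takeUntil y hy).support
  · right
    refine ⟨p.dropUntil y hy, fun z hz => ⟨p.support_dropUntil_subset_support hy hz, ?_⟩⟩
    rintro rfl
    rw [← p.take_spec hy] at hp
    exact hp.ne_of_mem_support_of_append hyx.symm hx hz rfl
  · left
    refine ReachableIn.symm ⟨p.takeUntil y hy, fun z hz =>
      ⟨p.support_takeUntil_subset_support hy hz, ?_⟩⟩
    rintro rfl
    exact hx hz

theorem center_eq_singleton_of_connected (hG : G.Connected) (hcover : ∀ t, t = u ∨ t = c ∨ t = v)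
    (huv : u ≠ v) (hadj : ¬ G.Adj u v) : G.center = {c} := by
  have : Nontrivial V := ⟨u, v, huv⟩
  have hcu : G.Adj c u := by
    obtain ⟨t, ht⟩ := hG.preconnected.exists_adj_of_nontrivial u
    rcases hcover t with rfl | rfl | rfl
    exacts [absurd rfl ht.ne, ht.symm, absurd ht hadj]
  have hcv : G.Adj c v := by
    obtain ⟨t, ht⟩ := hG.preconnected.exists_adj_of_nontrivial v
    rcases hcover t with rfl | rfl | rfl
    exacts [absurd ht.symm hadj, ht.symm, absurd rfl ht.ne]
  have hc : G.eccent c ≤ 1 := by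
    refine (SimpleGraph.eccent_le_one_iff c).2 fun t ht => ?_
    rcases hcover t with rfl | rfl | rfl
    exacts [hcu, absurd rfl ht, hcv]
  refine G.center_nonempty.subset_singleton_iff.1 fun t ht => ?_
  have hadj_t := (SimpleGraph.eccent_le_one_iff t).1
    (((SimpleGraph.mem_center_iff t).1 ht).le.trans (SimpleGraph.radius_le_eccent.trans hc))
  rcases hcover t with rfl | rfl | rfl
  · exact absurd (hadj_t v huv) hadj
  · rfl
  · exact absurd (hadj_t u huv.symm).symm hadj

end Reachability

section Branches

variable {W : Type*} {T : SimpleGraph W} {w : W → ℕ} {S A B : Set W} {c t u x y z : W} {n : ℕ}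

theorem setWeight_union [Finite W] (h : Disjoint A B) :
    setWeight w (A ∪ B) = setWeight w A + setWeight w B :=
  finsum_mem_union h A.toFinite B.toFinite

theorem setWeight_mono [Finite W] (h : A ⊆ B) : setWeight w A ≤ setWeight w B := by
  rw [← Set.union_sdiff_cancel h, setWeight_union Set.disjoint_sdiff_right]
  exact Nat.le_add_right _ _

theorem setWeight_singleton : setWeight w {x} = w x := finsum_mem_singleton

theorem weight_le_setWeight [Finite W] (h : x ∈ A) : w x ≤ setWeight w A :=
  setWeight_singleton.ge.trans (setWeight_mono (Set.singleton_subset_iff.2 h))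

/-- The vertex set of the component of `T - x` that contains `y` (empty if `y = x`). -/
def branch (T : SimpleGraph W) (x y : W) : Set W := {z | ReachableIn T {x}ᶜ y z}

theorem self_mem_branch (h : y ≠ x) : y ∈ branch T x y := ReachableIn.refl h

theorem notMem_branch : x ∉ branch T x y := fun h => h.right_mem rfl

theorem mem_branch_symm (h : z ∈ branch T x y) : y ∈ branch T x z := ReachableIn.symm h

theorem branch_eq_of_mem (h : z ∈ branch T x y) : branch T x z = branch T x y :=
  Set.ext fun _ => ⟨fun h' => ReachableIn.trans h h', fun h' => (ReachableIn.symm h).trans h'⟩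

theorem disjoint_branch (h : z ∉ branch T x y) : Disjoint (branch T x z) (branch T x y) :=
  Set.disjoint_left.2 fun _ h₁ h₂ => h (ReachableIn.trans h₂ (ReachableIn.symm h₁))

theorem subset_branch (hS : (T.induce S).Preconnected) (hx : x ∉ S) (hy : y ∈ S) :
    S ⊆ branch T x y := fun z hz =>
  (preconnected_induce_iff.1 hS y hy z hz).mono (Set.subset_compl_singleton_iff.2 hx)

theorem subtreeVerts_connectedComponentMk (h : y ≠ x) :
    subtreeVerts T x ((T.induce {x}ᶜ).connectedComponentMk ⟨y, h⟩) = branch T x y := by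
  ext z
  simp only [subtreeVerts, Set.mem_image, SimpleGraph.ConnectedComponent.mem_supp_iff,
    SimpleGraph.ConnectedComponent.eq]
  constructor
  · rintro ⟨s, hs, rfl⟩
    exact (reachableIn_iff_reachable_induce h s.2).2 hs.symm
  · intro hz
    exact ⟨⟨z, hz.right_mem⟩, ((reachableIn_iff_reachable_induce h hz.right_mem).1 hz).symm, rfl⟩

theorem subtreeVerts_injective : Function.Injective (subtreeVerts T x) := fun _ _ h =>
  SimpleGraph.ConnectedComponent.supp_injective (Subtype.val_injective.image_injective h)

theorem exists_subtreeVerts_eq_branch (C : (T.induce ({x}ᶜ : Set W)).ConnectedComponent) :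
    ∃ y ≠ x, subtreeVerts T x C = branch T x y := by
  induction C using SimpleGraph.ConnectedComponent.ind with
  | _ s => exact ⟨s, s.2, subtreeVerts_connectedComponentMk s.2⟩

theorem setWeight_branch_le_hs [Finite W] (h : y ≠ x) : setWeight w (branch T x y) ≤ hs T w x := by
  rw [← subtreeVerts_connectedComponentMk h]
  exact le_ciSup (f := fun C => setWeight w (subtreeVerts T x C)) (Set.finite_range _).bddAbove _

theorem hs_le (h : ∀ y, y ≠ x → setWeight w (branch T x y) ≤ n) : hs T w x ≤ n := by
  refine ciSup_le' fun C => ?_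
  obtain ⟨y, hy, hC⟩ := exists_subtreeVerts_eq_branch C
  exact hC ▸ h y hy

theorem exists_adj_mem_branch (hT : T.Connected) (h : y ≠ x) :
    ∃ u, T.Adj x u ∧ u ∈ branch T x y := by
  obtain ⟨p, hp⟩ := hT.exists_isPath x y
  cases p with
  | nil => exact absurd rfl h
  | @cons _ u _ hxu q =>
    rw [SimpleGraph.Walk.cons_isPath_iff] at hp
    exact ⟨u, hxu, ReachableIn.symm ⟨q, fun z hz => by rintro rfl; exact hp.2 hz⟩⟩

theorem exists_adj_subtreeVerts_eq_branch (hT : T.Connected)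
    (C : (T.induce ({x}ᶜ : Set W)).ConnectedComponent) :
    ∃ u, T.Adj x u ∧ subtreeVerts T x C = branch T x u := by
  obtain ⟨y, hy, hC⟩ := exists_subtreeVerts_eq_branch C
  obtain ⟨u, hu, huy⟩ := exists_adj_mem_branch hT hy
  exact ⟨u, hu, hC.trans (branch_eq_of_mem huy).symm⟩

theorem exists_adj_setWeight_branch_eq_hs [Finite W] (hT : T.Connected) (h : 0 < hs T w x) :
    ∃ y, T.Adj x y ∧ setWeight w (branch T x y) = hs T w x := by
  by_contra! hne
  suffices hs T w x ≤ hs T w x - 1 by omega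
  refine hs_le fun y hy => ?_
  obtain ⟨u, hu, huy⟩ := exists_adj_mem_branch hT hy
  have hlt := lt_of_le_of_ne (setWeight_branch_le_hs (T := T) (w := w) hu.ne') (hne u hu)
  rw [branch_eq_of_mem huy] at hlt
  omega

theorem branch_union_branch (hT : T.Connected) (h : x ≠ y) :
    branch T x y ∪ branch T y x = Set.univ := by
  refine Set.eq_univ_of_forall fun z => ?_
  obtain ⟨p, hp⟩ := hT.exists_isPath z y
  by_cases hx : x ∈ p.support
  · right
    rcases reachableIn_start_or_end_of_isPath hp hx h with hz | hy
    · exact hz.mono fun _ h => h.2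
    · exact absurd rfl hy.right_mem.2
  · exact .inl (ReachableIn.symm ⟨p, fun s hs => by rintro rfl; exact hx hs⟩)

theorem mem_branch_or_mem_branch (hT : T.Connected) (h : x ≠ y) (z : W) :
    z ∈ branch T x y ∨ z ∈ branch T y x :=
  (branch_union_branch hT h).ge (Set.mem_univ z)

theorem branch_subset_branch (hT : T.Connected) (h : x ≠ y) (hz : z ∉ branch T y x) :
    branch T y z ⊆ branch T x y := fun t ht =>
  (mem_branch_or_mem_branch hT h t).resolve_right (Set.disjoint_left.1 (disjoint_branch hz) ht)

theorem reachable_deleteEdges_of_mem_branch (h : z ∈ branch T x y) :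
    (T.deleteEdges {s(x, u)}).Reachable y z := by
  obtain ⟨p, hp⟩ := h
  refine ⟨p.toDeleteEdges _ fun e he => ?_⟩
  rintro rfl
  exact hp x (p.fst_mem_support_of_mem_edges he) rfl

theorem not_reachable_deleteEdges (hT : T.IsAcyclic) (h : T.Adj x y) :
    ¬ (T.deleteEdges {s(x, y)}).Reachable x y :=
  SimpleGraph.isBridge_iff.1 (SimpleGraph.isAcyclic_iff_forall_adj_isBridge.1 hT h)

theorem disjoint_branch_branch (hT : T.IsAcyclic) (h : T.Adj x y) :
    Disjoint (branch T x y) (branch T y x) := by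
  refine Set.disjoint_left.2 fun z hy hx => not_reachable_deleteEdges hT h ?_
  have hxz := reachable_deleteEdges_of_mem_branch (u := x) hx
  rw [Sym2.eq_swap] at hxz
  exact hxz.trans (reachable_deleteEdges_of_mem_branch hy).symm

theorem supp_deleteEdges_eq_branch (hT : T.IsTree) (h : T.Adj x y) :
    ((T.deleteEdges {s(x, y)}).connectedComponentMk y).supp = branch T x y := by
  ext z
  rw [SimpleGraph.ConnectedComponent.mem_supp_iff, SimpleGraph.ConnectedComponent.eq]
  refine ⟨fun hz => ?_, fun hz => (reachable_deleteEdges_of_mem_branch hz).symm⟩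
  refine (mem_branch_or_mem_branch hT.connected h.ne z).resolve_right fun hzx => ?_
  have hxz := reachable_deleteEdges_of_mem_branch (u := x) hzx
  rw [Sym2.eq_swap] at hxz
  exact not_reachable_deleteEdges hT.isAcyclic h (hxz.trans hz)

theorem eq_of_adj_of_mem_branch (hT : T.IsAcyclic) (hy : T.Adj x y) (hz : T.Adj x z)
    (h : z ∈ branch T x y) : z = y := by
  by_contra hne
  exact Set.disjoint_left.1 (disjoint_branch_branch hT hy) h (ReachableIn.of_adj hz hy.ne hne)

theorem mem_of_adj_of_adj_of_preconnected_induce (hT : T.IsAcyclic)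
    (hS : (T.induce S).Preconnected) (hy : T.Adj x y) (hz : T.Adj x z) (hyz : y ≠ z)
    (hyS : y ∈ S) (hzS : z ∈ S) : x ∈ S := by
  by_contra hx
  exact hyz (eq_of_adj_of_mem_branch hT hy hz (subset_branch hS hx hyS hzS)).symm

theorem mem_branch_of_adj (hT : T.IsAcyclic) (hxy : T.Adj x y) (hz : z ∈ branch T x y)
    (hzy : z ≠ y) (hzt : T.Adj z t) : t ∈ branch T x y := by
  refine ReachableIn.trans hz (ReachableIn.of_adj hzt hz.right_mem ?_)
  rintro rfl
  exact hzy (eq_of_adj_of_mem_branch hT hxy hzt.symm hz)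

end Branches

section Centroids

variable {W : Type*} [Finite W] {T : SimpleGraph W} {w : W → ℕ} {c x y : W}

theorem setWeight_univ_le_add (hT : T.Connected) (h : x ≠ y) :
    setWeight w Set.univ ≤ setWeight w (branch T x y) + setWeight w (branch T y x) := by
  rw [← branch_union_branch hT h, ← Set.union_sdiff_self, setWeight_union Set.disjoint_sdiff_right]
  exact Nat.add_le_add_left (setWeight_mono Set.sdiff_subset) _

theorem setWeight_branch_add (hT : T.IsTree) (h : T.Adj x y) :
    setWeight w (branch T x y) + setWeight w (branch T y x) = setWeight w Set.univ := by
  rw [← branch_union_branch hT.connected h.ne,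
    setWeight_union (disjoint_branch_branch hT.isAcyclic h)]

theorem exists_two_mul_hs_le (hT : T.IsTree) : ∃ c, 2 * hs T w c ≤ setWeight w Set.univ := by
  by_contra! hlt
  have heavy (x : W) : ∃ y, T.Adj x y ∧ setWeight w Set.univ < 2 * setWeight w (branch T x y) := by
    have hpos : 0 < hs T w x := by
      have := hlt x
      omega
    obtain ⟨y, hy, hxy⟩ := exists_adj_setWeight_branch_eq_hs hT.connected hpos
    exact ⟨y, hy, hxy ▸ hlt x⟩
  choose f hf hfw using heavy
  have := hT.connected.nonempty
  obtain ⟨c, hc⟩ := Finite.exists_min fun x => (branch T x (f x)).ncard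
  have hleave : f (f c) ∉ branch T (f c) c := fun h => by
    have hcw := hfw c
    have hcw' := hfw (f c)
    have hsum := setWeight_branch_add (w := w) hT (hf c)
    rw [branch_eq_of_mem h] at hcw'
    omega
  have hss : branch T (f c) (f (f c)) ⊂ branch T c (f c) :=
    ⟨branch_subset_branch hT.connected (hf c).ne hleave,
      fun h => notMem_branch (h (self_mem_branch (hf c).ne'))⟩
  exact (hc (f c)).not_gt (Set.ncard_lt_ncard hss)

theorem two_mul_hs_le_of_mem_centroids (hT : T.IsTree) (hc : c ∈ centroids T w) :
    2 * hs T w c ≤ setWeight w Set.univ := by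
  obtain ⟨d, hd⟩ := exists_two_mul_hs_le (w := w) hT
  exact (Nat.mul_le_mul_left 2 (hc d)).trans hd

theorem centroids_eq_singleton (hT : T.Connected) (hc : 2 * hs T w c < setWeight w Set.univ) :
    centroids T w = {c} := by
  have hlt (x : W) (hx : x ≠ c) : hs T w c < hs T w x := by
    have hsum := setWeight_univ_le_add (w := w) hT hx
    have hxc := setWeight_branch_le_hs (T := T) (w := w) hx
    have hcx := setWeight_branch_le_hs (T := T) (w := w) hx.symm
    omega
  refine Set.eq_singleton_iff_unique_mem.2 ⟨fun x => ?_, fun x hx => ?_⟩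
  · obtain rfl | hne := eq_or_ne x c
    exacts [le_rfl, (hlt x hne).le]
  · by_contra hne
    exact (hx c).not_gt (hlt x hne)

end Centroids

section HalvingEdges

variable {W : Type*} {T : SimpleGraph W} {w : W → ℕ} {S A B : Set W} {c t u v x y z : W}

/-- The ends `x`, `y` of an edge of `T` such that the component of `T - x` containing `y` and the
component of `T - y` containing `x` have the same weight. In a tree these are the two components
of `T` without the edge. -/
structure IsHalving (T : SimpleGraph W) (w : W → ℕ) (x y : W) : Prop where
  adj : T.Adj x y
  setWeight_eq : setWeight w (branch T x y) = setWeight w (branch T y x)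

theorem IsHalving.symm (h : IsHalving T w x y) : IsHalving T w y x :=
  ⟨h.adj.symm, h.setWeight_eq.symm⟩

variable [Finite W]

theorem weight_eq_zero_of_setWeight_le (hAB : A ⊆ B) (h : setWeight w B ≤ setWeight w A)
    (hxB : x ∈ B) (hxA : x ∉ A) : w x = 0 := by
  have hsum := setWeight_union (w := w) (Set.disjoint_sdiff_right (s := A) (t := B))
  rw [Set.union_sdiff_cancel hAB] at hsum
  have := weight_le_setWeight (w := w) (show x ∈ B \ A from ⟨hxB, hxA⟩)
  omega

theorem IsHalving.two_mul_setWeight_branch (hT : T.IsTree) (h : IsHalving T w x y) :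
    2 * setWeight w (branch T x y) = setWeight w Set.univ := by
  have := setWeight_branch_add (w := w) hT h.adj
  have := h.setWeight_eq
  omega

theorem exists_isHalving (hT : T.IsTree) (hyx : y ≠ x)
    (h : 2 * setWeight w (branch T x y) = setWeight w Set.univ) :
    ∃ u ∈ branch T x y, IsHalving T w x u := by
  obtain ⟨u, hu, huy⟩ := exists_adj_mem_branch hT.connected hyx
  have := setWeight_branch_add (w := w) hT hu
  rw [← branch_eq_of_mem huy] at h
  exact ⟨u, huy, hu, by omega⟩

theorem IsHalving.le_two_mul_hs (hT : T.IsTree) (h : IsHalving T w x y) (z : W) :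
    setWeight w Set.univ ≤ 2 * hs T w z := by
  wlog hz : z ∈ branch T x y generalizing x y
  · exact this h.symm ((mem_branch_or_mem_branch hT.connected h.adj.ne z).resolve_left hz)
  rw [← h.symm.two_mul_setWeight_branch hT]
  refine Nat.mul_le_mul_left 2 ?_
  obtain rfl | hzy := eq_or_ne z y
  · exact setWeight_branch_le_hs h.adj.ne
  have hx : x ∉ branch T y z := fun hx =>
    Set.disjoint_left.1 (disjoint_branch_branch hT.isAcyclic h.adj) hz (mem_branch_symm hx)
  exact (setWeight_mono (branch_subset_branch hT.connected hzy hx)).trans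
    (setWeight_branch_le_hs hzy.symm)

theorem IsHalving.two_mul_hs_le (hT : T.IsTree) (h : IsHalving T w x y) :
    2 * hs T w x ≤ setWeight w Set.univ := by
  rw [← h.two_mul_setWeight_branch hT]
  refine Nat.mul_le_mul_left 2 (hs_le fun z _ => ?_)
  by_cases hzy : z ∈ branch T x y
  · rw [branch_eq_of_mem hzy]
  · rw [h.setWeight_eq]
    exact setWeight_mono (branch_subset_branch hT.connected h.adj.ne' hzy)

theorem IsHalving.mem_centroids (hT : T.IsTree) (h : IsHalving T w x y) : x ∈ centroids T w :=
  fun z => Nat.le_of_mul_le_mul_left ((h.two_mul_hs_le hT).trans (h.le_two_mul_hs hT z)) two_pos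

theorem exists_centroids_eq_singleton_or_exists_isHalving (hT : T.IsTree)
    (hw : 0 < setWeight w Set.univ) :
    (∃ c, centroids T w = {c} ∧ 2 * hs T w c < setWeight w Set.univ) ∨
      ∃ x y, IsHalving T w x y := by
  obtain ⟨c, hc⟩ := exists_two_mul_hs_le (w := w) hT
  rcases hc.lt_or_eq with hlt | heq
  · exact .inl ⟨c, centroids_eq_singleton hT.connected hlt, hlt⟩
  · obtain ⟨y, hy, hyc⟩ :=
      exists_adj_setWeight_branch_eq_hs (T := T) (w := w) (x := c) hT.connected (by omega)
    obtain ⟨u, -, hu⟩ := exists_isHalving hT hy.ne' (hyc ▸ heq)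
    exact .inr ⟨c, u, hu⟩

theorem IsHalving.exists_ne_isHalving (hT : T.IsTree) (h : IsHalving T w x y)
    (hz : z ∈ centroids T w) (hzb : z ∈ branch T x y) (hzy : z ≠ y) :
    ∃ u, u ≠ x ∧ IsHalving T w y u := by
  have hzx : z ∉ branch T y x :=
    Set.disjoint_left.1 (disjoint_branch_branch hT.isAcyclic h.adj) hzb
  have hyz : 2 * setWeight w (branch T y z) = setWeight w Set.univ := by
    have hle := setWeight_mono (w := w) (branch_subset_branch hT.connected h.adj.ne hzx)
    have hhalf := h.two_mul_setWeight_branch hT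
    have hhs := two_mul_hs_le_of_mem_centroids hT hz
    have hzy_le := setWeight_branch_le_hs (T := T) (w := w) hzy.symm
    have hsum := setWeight_univ_le_add (w := w) hT.connected hzy
    omega
  obtain ⟨u, huz, hu⟩ := exists_isHalving hT hzy hyz
  refine ⟨u, ?_, hu⟩
  rintro rfl
  exact hzx (mem_branch_symm huz)

theorem IsHalving.weight_eq_zero (hT : T.IsTree) (hu : IsHalving T w c u) (hv : IsHalving T w c v)
    (huv : u ≠ v) (hzu : z ∉ branch T c u) (hzv : z ∉ branch T c v) : w z = 0 := by
  have hdisj : Disjoint (branch T c u) (branch T c v) :=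
    disjoint_branch fun h => huv (eq_of_adj_of_mem_branch hT.isAcyclic hv.adj hu.adj h)
  refine weight_eq_zero_of_setWeight_le (Set.subset_univ (branch T c u ∪ branch T c v)) ?_
    (Set.mem_univ z) (by simp [hzu, hzv])
  have := hu.two_mul_setWeight_branch hT
  have := hv.two_mul_setWeight_branch hT
  rw [setWeight_union hdisj]
  omega

theorem IsHalving.eq_of_mem_centroids (hT : T.IsTree) (h : IsHalving T w x y) (hy : w y ≠ 0)
    (hz : z ∈ centroids T w) (hzb : z ∈ branch T x y) : z = y := by
  by_contra hzy
  obtain ⟨u, hux, hu⟩ := h.exists_ne_isHalving hT hz hzb hzy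
  exact hy (hu.weight_eq_zero hT h.symm hux notMem_branch notMem_branch)

theorem IsHalving.centroids_eq_pair_or_exists_isHalving (hT : T.IsTree) (h : IsHalving T w x y) :
    centroids T w = {x, y} ∨ ∃ c u v, u ≠ v ∧ IsHalving T w c u ∧ IsHalving T w c v := by
  refine or_iff_not_imp_right.2 fun hno => Set.Subset.antisymm (fun z hz => ?_) ?_
  · by_contra hne
    simp only [Set.mem_insert_iff, Set.mem_singleton_iff, not_or] at hne
    rcases mem_branch_or_mem_branch hT.connected h.adj.ne z with hzb | hzb
    · obtain ⟨u, hux, hu⟩ := h.exists_ne_isHalving hT hz hzb hne.2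
      exact hno ⟨y, u, x, hux, hu, h.symm⟩
    · obtain ⟨u, huy, hu⟩ := h.symm.exists_ne_isHalving hT hz hzb hne.1
      exact hno ⟨x, u, y, huy, hu, h⟩
  · rintro z (rfl | rfl)
    exacts [h.mem_centroids hT, h.symm.mem_centroids hT]

theorem VertexHalves.exists_isHalving_and_isHalving (hT : T.IsTree)
    (h : VertexHalves T w (setWeight w Set.univ) c) :
    ∃ u v, u ≠ v ∧ IsHalving T w c u ∧ IsHalving T w c v := by
  have key (C : (T.induce ({c}ᶜ : Set W)).ConnectedComponent)
      (hC : (setWeight w (subtreeVerts T c C) : ℚ) = (setWeight w Set.univ : ℕ) / 2) :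
      ∃ u, subtreeVerts T c C = branch T c u ∧ IsHalving T w c u := by
    obtain ⟨u, hu, hCu⟩ := exists_adj_subtreeVerts_eq_branch hT.connected C
    rw [hCu, eq_div_iff two_ne_zero, mul_comm] at hC
    obtain ⟨v, hv, hcv⟩ := exists_isHalving hT hu.ne' (by exact_mod_cast hC)
    exact ⟨v, hCu.trans (branch_eq_of_mem hv).symm, hcv⟩
  obtain ⟨C₁, C₂, hne, -, h₁, h₂⟩ := h
  obtain ⟨u, hCu, hu⟩ := key C₁ h₁
  obtain ⟨v, hCv, hv⟩ := key C₂ h₂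
  refine ⟨u, v, ?_, hu, hv⟩
  rintro rfl
  exact hne (subtreeVerts_injective (hCu.trans hCv.symm))

theorem VertexHalves.two_lt_ncard_centroids (hT : T.IsTree)
    (h : VertexHalves T w (setWeight w Set.univ) c) : 2 < (centroids T w).ncard := by
  obtain ⟨u, v, huv, hu, hv⟩ := h.exists_isHalving_and_isHalving hT
  rw [Set.two_lt_ncard]
  exact ⟨c, hu.mem_centroids hT, u, hu.symm.mem_centroids hT, v, hv.symm.mem_centroids hT,
    hu.adj.ne, hv.adj.ne, huv⟩

end HalvingEdges

section SparseZeros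

variable {W : Type*} {T : SimpleGraph W} {w : W → ℕ} {S : Set W} {c t u v x y z : W}

/-- The two properties of block trees that the analysis of centroids uses: a vertex of weight zero
has at least two neighbours, and all its neighbours have positive weight. -/
structure HasSparseZeros (T : SimpleGraph W) (w : W → ℕ) : Prop where
  nontrivial_neighborSet : ∀ x, w x = 0 → (T.neighborSet x).Nontrivial
  ne_zero_of_adj : ∀ x y, T.Adj x y → w x = 0 → w y ≠ 0

variable [Finite W]

theorem IsHalving.neighborSet_eq (hT : T.IsTree) (hw : HasSparseZeros T w)
    (hu : IsHalving T w c u) (hv : IsHalving T w c v) (huv : u ≠ v) :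
    T.neighborSet c = {u, v} := by
  have hc : w c = 0 := hu.weight_eq_zero hT hv huv notMem_branch notMem_branch
  refine Set.Subset.antisymm (fun t (ht : T.Adj c t) => ?_) ?_
  · by_contra hne
    simp only [Set.mem_insert_iff, Set.mem_singleton_iff, not_or] at hne
    exact hw.ne_zero_of_adj c t ht hc (hu.weight_eq_zero hT hv huv
      (fun h => hne.1 (eq_of_adj_of_mem_branch hT.isAcyclic hu.adj ht h))
      (fun h => hne.2 (eq_of_adj_of_mem_branch hT.isAcyclic hv.adj ht h)))
  · rintro t (rfl | rfl)
    exacts [hu.adj, hv.adj]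

theorem IsHalving.mem_branch_or_mem_branch_of_ne (hT : T.IsTree) (hw : HasSparseZeros T w)
    (hu : IsHalving T w c u) (hv : IsHalving T w c v) (huv : u ≠ v) (hz : z ≠ c) :
    z ∈ branch T c u ∨ z ∈ branch T c v := by
  obtain ⟨t, ht, htz⟩ := exists_adj_mem_branch hT.connected hz
  rcases (hu.neighborSet_eq hT hw hv huv).le ht with rfl | rfl
  exacts [.inl (mem_branch_symm htz), .inr (mem_branch_symm htz)]

theorem IsHalving.centroids_eq_triple (hT : T.IsTree) (hw : HasSparseZeros T w)
    (hu : IsHalving T w c u) (hv : IsHalving T w c v) (huv : u ≠ v) :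
    centroids T w = {u, c, v} := by
  have hc : w c = 0 := hu.weight_eq_zero hT hv huv notMem_branch notMem_branch
  refine Set.Subset.antisymm (fun z hz => ?_) ?_
  · obtain rfl | hzc := eq_or_ne z c
    · exact .inr (.inl rfl)
    rcases hu.mem_branch_or_mem_branch_of_ne hT hw hv huv hzc with hzu | hzv
    · exact .inl (hu.eq_of_mem_centroids hT (hw.ne_zero_of_adj c u hu.adj hc) hz hzu)
    · exact .inr (.inr (hv.eq_of_mem_centroids hT (hw.ne_zero_of_adj c v hv.adj hc) hz hzv))
  · rintro z (rfl | rfl | rfl)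
    exacts [hu.symm.mem_centroids hT, hu.mem_centroids hT, hv.symm.mem_centroids hT]

theorem IsHalving.vertexHalves (hT : T.IsTree) (hw : HasSparseZeros T w)
    (hu : IsHalving T w c u) (hv : IsHalving T w c v) (huv : u ≠ v) :
    VertexHalves T w (setWeight w Set.univ) c := by
  have hu' := subtreeVerts_connectedComponentMk (T := T) hu.adj.ne'
  have hv' := subtreeVerts_connectedComponentMk (T := T) hv.adj.ne'
  refine ⟨_, _, fun h => huv ?_, fun C => ?_, (congrArg _ (congrArg _ hu')).trans ?_,
    (congrArg _ (congrArg _ hv')).trans ?_⟩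
  · refine eq_of_adj_of_mem_branch hT.isAcyclic hv.adj hu.adj ?_
    rw [← hv', ← h, hu']
    exact self_mem_branch hu.adj.ne'
  · obtain ⟨z, hz, hCz⟩ := exists_subtreeVerts_eq_branch C
    refine (hu.mem_branch_or_mem_branch_of_ne hT hw hv huv hz).imp (fun h => ?_) fun h => ?_
    · exact subtreeVerts_injective (hCz.trans ((branch_eq_of_mem h).trans hu'.symm))
    · exact subtreeVerts_injective (hCz.trans ((branch_eq_of_mem h).trans hv'.symm))
  · rw [eq_div_iff two_ne_zero, mul_comm]
    exact_mod_cast hu.two_mul_setWeight_branch hT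
  · rw [eq_div_iff two_ne_zero, mul_comm]
    exact_mod_cast hv.two_mul_setWeight_branch hT

theorem IsHalving.two_mul_setWeight_lt (hT : T.IsTree) (h : IsHalving T w x y)
    (hcent : centroids T w = {x, y}) (hS : (T.induce S).Connected) (hSb : S ⊆ branch T x y)
    (hy : y ∉ S) : 2 * setWeight w S < setWeight w Set.univ := by
  obtain ⟨s, hs⟩ := hS.nonempty
  have hsx : s ∉ branch T y x :=
    Set.disjoint_left.1 (disjoint_branch_branch hT.isAcyclic h.adj) (hSb hs)
  have hle := setWeight_mono (w := w) (subset_branch hS.preconnected hy hs)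
  have hle' := setWeight_mono (w := w) (branch_subset_branch hT.connected h.adj.ne hsx)
  have hhalf := h.two_mul_setWeight_branch hT
  by_contra! hlt
  obtain ⟨u, hus, hu⟩ :=
    exists_isHalving (w := w) hT (y := s) (x := y) (fun hsy => hy (hsy ▸ hs)) (by omega)
  rcases hcent.le (hu.symm.mem_centroids hT) with rfl | rfl
  · exact hsx (mem_branch_symm hus)
  · exact hu.adj.ne rfl

theorem IsHalving.properSubtreesWeighAtMost (hT : T.IsTree) (hw : HasSparseZeros T w)
    (h : IsHalving T w x y) (hcent : centroids T w = {x, y}) :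
    ProperSubtreesWeighAtMost T w (branch T x y) ((setWeight w Set.univ : ℕ) / 2 - 1) := by
  intro S hSb hS
  have hhalf := h.two_mul_setWeight_branch hT
  suffices hlt : setWeight w S < setWeight w (branch T x y) by
    rw [← hhalf, Nat.cast_mul, Nat.cast_two, mul_div_cancel_left₀ _ two_ne_zero, le_sub_iff_add_le]
    exact_mod_cast hlt
  by_contra! hle
  have hyS : y ∈ S := by
    by_contra hyS
    have := h.two_mul_setWeight_lt hT hcent hS hSb.1 hyS
    omega
  obtain ⟨z, hz, hzS⟩ := Set.exists_of_ssubset hSb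
  have hz0 : w z = 0 := weight_eq_zero_of_setWeight_le hSb.1 hle hz hzS
  have hmem (t : W) (ht : T.Adj z t) : t ∈ S := by
    by_contra htS
    have htb := mem_branch_of_adj hT.isAcyclic h.adj hz (fun hzy => hzS (hzy ▸ hyS)) ht
    exact hw.ne_zero_of_adj z t ht hz0 (weight_eq_zero_of_setWeight_le hSb.1 hle htb htS)
  obtain ⟨s, hs, t, ht, hst⟩ := hw.nontrivial_neighborSet z hz0
  exact hzS (mem_of_adj_of_adj_of_preconnected_induce hT.isAcyclic hS.preconnected hs ht hst
    (hmem s hs) (hmem t ht))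

theorem IsHalving.edgeHalves (hT : T.IsTree) (hw : HasSparseZeros T w) (h : IsHalving T w x y)
    (hcent : centroids T w = {x, y}) : EdgeHalves T w (setWeight w Set.univ) x y := by
  have hy := supp_deleteEdges_eq_branch hT h.adj
  have hx := supp_deleteEdges_eq_branch hT h.adj.symm
  rw [Sym2.eq_swap] at hx
  refine ⟨_, _, rfl, rfl, fun hxy => not_reachable_deleteEdges hT.isAcyclic h.adj
    (SimpleGraph.ConnectedComponent.eq.1 hxy), fun C => ?_, ?_⟩
  · induction C using SimpleGraph.ConnectedComponent.ind with
    | _ z =>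
      exact (mem_branch_or_mem_branch hT.connected h.adj.ne z).symm.imp
        (fun hz => hx.ge hz) fun hz => hy.ge hz
  rw [hx, hy]
  refine ⟨?_, ?_, h.symm.properSubtreesWeighAtMost hT hw (hcent.trans (Set.pair_comm x y)),
    h.properSubtreesWeighAtMost hT hw hcent⟩
  · rw [eq_div_iff two_ne_zero, mul_comm]
    exact_mod_cast h.symm.two_mul_setWeight_branch hT
  · rw [eq_div_iff two_ne_zero, mul_comm]
    exact_mod_cast h.two_mul_setWeight_branch hT

end SparseZeros

section CentralCentroid

variable {W : Type*} {T : SimpleGraph W} {w : W → ℕ} {c u v x : W}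

theorem isCentralCentroid_iff_eq (hcent : centroids T w = {u, c, v}) (hu : T.Adj u c)
    (hv : T.Adj c v) (huv : u ≠ v) (hadj : ¬ T.Adj u v) : IsCentralCentroid T w x ↔ x = c := by
  have center_eq {a b : W} (P : T.Walk a b) (hP : P.toSubgraph.verts = centroids T w) :
      Subtype.val '' P.toSubgraph.coe.center = {c} := by
    have hmem (t : W) : t ∈ P.toSubgraph.verts ↔ t = u ∨ t = c ∨ t = v := by rw [hP, hcent]; rfl
    rw [center_eq_singleton_of_connected (u := ⟨u, (hmem u).2 (.inl rfl)⟩)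
      (c := ⟨c, (hmem c).2 (.inr (.inl rfl))⟩) (v := ⟨v, (hmem v).2 (.inr (.inr rfl))⟩)
      P.toSubgraph_connected.coe (fun t => by simpa [Subtype.ext_iff] using (hmem t).1 t.2)
      (fun h => huv (congrArg Subtype.val h)) fun h => hadj h.adj_sub, Set.image_singleton]
  constructor
  · rintro ⟨a, b, P, -, hP, hx, hxc⟩
    exact (center_eq P hP).le ⟨_, hxc, rfl⟩
  · rintro rfl
    let P : T.Walk u v := .cons hu (.cons hv .nil)
    have hP : P.toSubgraph.verts = centroids T w := by
      ext t
      simp only [hcent, P, SimpleGraph.Walk.mem_verts_toSubgraph, SimpleGraph.Walk.support_cons,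
        SimpleGraph.Walk.support_nil, List.mem_cons, List.not_mem_nil, or_false,
        Set.mem_insert_iff, Set.mem_singleton_iff]
    have hx : x ∈ Subtype.val '' P.toSubgraph.coe.center := (center_eq P hP).ge rfl
    exact ⟨u, v, P, by simp [P, hu.ne, hv.ne, huv], hP, by simpa using hx⟩

end CentralCentroid

section Blocks

variable {V : Type*} {G : SimpleGraph V} {S S' B B' : Set V} {a b u v : V}

theorem not_isCutVertex_iff :
    ¬ IsCutVertex G v ↔ ∀ a b, G.Reachable a b → a ≠ v → b ≠ v → ReachableIn G {v}ᶜ a b := by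
  constructor
  · intro h a b hab ha hb
    by_contra hab'
    exact h ⟨⟨a, ha⟩, ⟨b, hb⟩, hab, fun hr => hab' ((reachableIn_iff_reachable_induce _ _).2 hr)⟩
  · rintro h ⟨a, b, hab, hab'⟩
    exact hab' ((reachableIn_iff_reachable_induce _ _).1 (h a b hab a.2 b.2))

theorem IsCutVertex.exists_adj (h : IsCutVertex G v) : ∃ u, G.Adj v u := by
  classical
  obtain ⟨a, b, ⟨p⟩, hab⟩ := h
  by_cases hv : v ∈ p.support
  · obtain ⟨u, hvu, -⟩ := SimpleGraph.Walk.exists_eq_cons_of_ne (Ne.symm b.2) (p.dropUntil v hv)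
    exact ⟨u, hvu⟩
  · exact absurd ⟨p.induce {v}ᶜ fun z hz => by rintro rfl; exact hv hz⟩ hab

theorem not_isCutVertex_induce_iff (hS : (G.induce S).Preconnected) {x : S} :
    ¬ IsCutVertex (G.induce S) x ↔ (G.induce (S \ {x.1})).Preconnected := by
  let e : (G.induce S).induce {x}ᶜ ≃g G.induce (S \ {x.1}) :=
    { toFun a := ⟨a.1, a.1.2, fun h => a.2 (Subtype.ext h)⟩
      invFun a := ⟨⟨a, a.2.1⟩, fun h => a.2.2 (congrArg Subtype.val h)⟩
      left_inv _ := rfl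
      right_inv _ := rfl
      map_rel_iff' := Iff.rfl }
  rw [← e.preconnected_iff, preconnected_induce_iff, not_isCutVertex_iff]
  exact ⟨fun h a ha b hb => h a b (hS a b) ha hb, fun h a b _ ha hb => h a ha b hb⟩

/-- `S` induces a connected subgraph that stays connected when any vertex is deleted. The blocks of
`G` are the maximal such sets; single vertices and edges qualify. -/
structure IsNonseparable (G : SimpleGraph V) (S : Set V) : Prop where
  connected : (G.induce S).Connected
  preconnected_diff : ∀ x, (G.induce (S \ {x})).Preconnected

theorem isNonseparable_iff :
    IsNonseparable G S ↔ (G.induce S).Connected ∧ ∀ x : S, ¬ IsCutVertex (G.induce S) x := by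
  constructor
  · exact fun h => ⟨h.connected, fun x =>
      (not_isCutVertex_induce_iff h.connected.preconnected).2 (h.preconnected_diff x)⟩
  · rintro ⟨hS, h⟩
    refine ⟨hS, fun x => ?_⟩
    by_cases hx : x ∈ S
    · exact (not_isCutVertex_induce_iff hS.preconnected).1 (h ⟨x, hx⟩)
    · rw [Set.sdiff_singleton_eq_self hx]
      exact hS.preconnected

theorem isBlock_iff_maximal_isNonseparable : IsBlock G B ↔ Maximal (IsNonseparable G) B := by
  simp only [IsBlock, ← isNonseparable_iff]

theorem IsBlock.isNonseparable (h : IsBlock G B) : IsNonseparable G B :=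
  (isBlock_iff_maximal_isNonseparable.1 h).prop

theorem IsBlock.nonempty (h : IsBlock G B) : B.Nonempty :=
  Set.nonempty_coe_sort.1 h.isNonseparable.connected.nonempty

theorem IsBlock.eq_of_subset (h : IsBlock G B) (hS : IsNonseparable G S) (hB : B ⊆ S) : B = S :=
  (isBlock_iff_maximal_isNonseparable.1 h).eq_of_subset hS hB

theorem isNonseparable_singleton : IsNonseparable G {v} where
  connected := SimpleGraph.induce_singleton_eq_top G v ▸ SimpleGraph.connected_top
  preconnected_diff x :=
    have : Subsingleton ↑({v} \ {x} : Set V) :=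
      (Set.subsingleton_singleton.anti Set.sdiff_subset).coe_sort
    .of_subsingleton

theorem isNonseparable_pair (h : G.Adj a b) : IsNonseparable G {a, b} where
  connected := SimpleGraph.induce_pair_connected_of_adj h
  preconnected_diff x := by
    by_cases hx : x ∈ ({a, b} : Set V)
    · have : Subsingleton ↑({a, b} \ {x} : Set V) := by
        rw [Set.subsingleton_coe]
        grind [Set.Subsingleton]
      exact .of_subsingleton
    · rw [Set.sdiff_singleton_eq_self hx]
      exact (SimpleGraph.induce_pair_connected_of_adj h).preconnected

theorem IsNonseparable.union (hS : IsNonseparable G S) (hS' : IsNonseparable G S')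
    (h : (S ∩ S').Nontrivial) : IsNonseparable G (S ∪ S') where
  connected := SimpleGraph.induce_union_connected hS.connected.preconnected
    hS'.connected.preconnected h.nonempty
  preconnected_diff x := by
    obtain ⟨c, ⟨hc, hc'⟩, hcx⟩ := h.exists_ne x
    rw [Set.union_sdiff_distrib]
    exact (SimpleGraph.induce_union_connected (hS.preconnected_diff x) (hS'.preconnected_diff x)
      ⟨c, ⟨hc, hcx⟩, hc', hcx⟩).preconnected

theorem IsNonseparable.union_ear (hS : IsNonseparable G S) {p : G.Walk a b} (hp : p.IsPath)
    (ha : a ∈ S) (hb : b ∈ S) : IsNonseparable G (S ∪ {z | z ∈ p.support}) where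
  connected := SimpleGraph.induce_union_connected hS.connected.preconnected
    p.connected_induce_support.preconnected ⟨a, ha, p.start_mem_support⟩
  preconnected_diff x := by
    rw [Set.union_sdiff_distrib]
    refine preconnected_induce_of_subset (hS.preconnected_diff x) Set.subset_union_left ?_
    rintro y (hy | ⟨hy, hyx⟩)
    · exact ⟨y, hy, .refl (.inl hy)⟩
    · rcases reachableIn_start_or_end_of_isPath hp hy hyx with h | h
      · exact ⟨a, ⟨ha, h.right_mem.2⟩, h.mono Set.subset_union_right⟩
      · exact ⟨b, ⟨hb, h.right_mem.2⟩, h.mono Set.subset_union_right⟩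

theorem IsNonseparable.diff_singleton_subset_branch (hS : IsNonseparable G S) (hu : u ∈ S)
    (hub : u ∈ branch G v b) : S \ {v} ⊆ branch G v b :=
  branch_eq_of_mem hub ▸
    subset_branch (hS.preconnected_diff v) (fun h => h.2 rfl) ⟨hu, hub.right_mem⟩

theorem IsBlock.eq_of_nontrivial_inter (hB : IsBlock G B) (hB' : IsBlock G B')
    (h : (B ∩ B').Nontrivial) : B = B' := by
  have hunion := hB.isNonseparable.union hB'.isNonseparable h
  exact (hB.eq_of_subset hunion Set.subset_union_left).trans
    (hB'.eq_of_subset hunion Set.subset_union_right).symm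

theorem IsBlock.eq_of_mem_branch (hB : IsBlock G B) (hB' : IsBlock G B') (hv : v ∈ B)
    (hv' : v ∈ B') (ha : a ∈ B) (hb : b ∈ B') (h : b ∈ branch G v a) : B = B' := by
  classical
  obtain ⟨c, hc, hvc⟩ := exists_mem_adj_of_preconnected_induce
    hB'.isNonseparable.connected.preconnected hv' hb (Ne.symm h.right_mem)
  obtain ⟨p, hp⟩ : c ∈ branch G v a :=
    hB'.isNonseparable.diff_singleton_subset_branch hb h ⟨hc, hvc.ne'⟩
  have hvp : v ∉ p.bypass.support := fun h => hp v (p.support_bypass_subset_support h) rfl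
  have hear := hB.isNonseparable.union_ear (p.bypass_isPath.concat hvp hvc.symm) ha hv
  have hcB : c ∈ B := by
    rw [hB.eq_of_subset hear Set.subset_union_left]
    exact .inr (by simp [SimpleGraph.Walk.support_concat])
  exact hB.eq_of_nontrivial_inter hB' ⟨v, ⟨hv, hv'⟩, c, ⟨hcB, hc⟩, hvc.ne⟩

theorem IsNonseparable.exists_isBlock [Finite V] (hS : IsNonseparable G S) :
    ∃ B, IsBlock G B ∧ S ⊆ B := by
  obtain ⟨B, hSB, hB⟩ := Finite.exists_le_maximal hS
  exact ⟨B, isBlock_iff_maximal_isNonseparable.2 hB, hSB⟩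

theorem exists_isBlock_mem [Finite V] (v : V) : ∃ B, IsBlock G B ∧ v ∈ B := by
  obtain ⟨B, hB, hvB⟩ := (isNonseparable_singleton (G := G) (v := v)).exists_isBlock
  exact ⟨B, hB, hvB rfl⟩

theorem IsBlock.exists_ne_mem (hB : IsBlock G B) (hv : IsCutVertex G v) : ∃ b ∈ B, b ≠ v := by
  by_contra! h
  obtain ⟨c, hvc⟩ := hv.exists_adj
  have hcB : c ∈ B := by
    rw [hB.eq_of_subset (isNonseparable_pair hvc) fun b hb => .inl (h b hb)]
    exact .inr rfl
  exact hvc.ne' (h c hcB)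

theorem IsBlock.eq_of_not_isCutVertex (hB : IsBlock G B) (hB' : IsBlock G B')
    (hv : ¬ IsCutVertex G v) (h : v ∈ B) (h' : v ∈ B') : B = B' := by
  by_cases hs : B ⊆ {v}
  · exact hB.eq_of_subset hB'.isNonseparable fun b hb => hs hb ▸ h'
  by_cases hs' : B' ⊆ {v}
  · exact (hB'.eq_of_subset hB.isNonseparable fun b hb => hs' hb ▸ h).symm
  obtain ⟨a, ha, hav⟩ := Set.not_subset.1 hs
  obtain ⟨b, hb, hbv⟩ := Set.not_subset.1 hs'
  have reachable {D : Set V} (hD : IsBlock G D) {x y : V} (hx : x ∈ D) (hy : y ∈ D) :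
      G.Reachable x y :=
    (hD.isNonseparable.connected.preconnected ⟨x, hx⟩ ⟨y, hy⟩).map
      (SimpleGraph.Embedding.induce D).toHom
  exact hB.eq_of_mem_branch hB' h h' ha hb
    (not_isCutVertex_iff.1 hv a b ((reachable hB ha h).trans (reachable hB' h' hb)) hav hbv)

theorem nonempty_iso_of_isBlock_pair (hab : a ≠ b) (h : IsBlock G {a, b}) :
    Nonempty (G.induce {a, b} ≃g (⊤ : SimpleGraph (Fin 2))) := by
  obtain ⟨c, rfl | rfl, hadj⟩ := exists_mem_adj_of_preconnected_induce
    h.isNonseparable.connected.preconnected (.inl rfl) (.inr rfl) hab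
  · exact absurd rfl hadj.ne
  · have htop : G.induce {a, c} = ⊤ :=
      SimpleGraph.induce_eq_top.2 (SimpleGraph.isClique_pair.2 fun _ => hadj)
    rw [htop]
    exact ⟨.completeGraph (Finite.equivFinOfCardEq (Set.ncard_pair hab))⟩

end Blocks

section BlockTrees

variable {V : Type*} {G : SimpleGraph V} {a b v : V} {x y : Node G}

/-- The nodes of the block tree that lie in the component of `G - v` containing `b`: the cut
vertices in that component and the blocks all of whose vertices other than `v` belong to it. -/
def nodesInBranch (G : SimpleGraph V) (v b : V) : Set (Node G) :=
  {x | match x with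
    | .inl u => u.1 ∈ branch G v b
    | .inr B => B.1 \ {v} ⊆ branch G v b}

theorem eq_of_adj_of_mem_nodesInBranch {v : {v : V // IsCutVertex G v}}
    {B : {B : Set V // IsBlock G B}} (hv : v.1 ∈ B.1) (hb : b ∈ B.1)
    (hxy : (blockTree G).Adj x y) (hx : x ∈ nodesInBranch G v b) (hy : y ∉ nodesInBranch G v b) :
    x = .inr B ∧ y = .inl v := by
  rcases x with u | D <;> rcases y with u' | D'
  · exact hxy.elim
  · exact absurd (D'.2.isNonseparable.diff_singleton_subset_branch hxy hx) hy
  · obtain rfl : u' = v := by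
      by_contra hne
      exact hy (hx ⟨hxy, fun h => hne (Subtype.ext h)⟩)
    obtain ⟨d, hd, hdv⟩ := D.2.exists_ne_mem u'.2
    exact ⟨congrArg Sum.inr (Subtype.ext
      (B.2.eq_of_mem_branch D.2 hv hxy hb hd (hx ⟨hd, hdv⟩)).symm), rfl⟩
  · exact hxy.elim

theorem isBridge_blockTree {v : {v : V // IsCutVertex G v}} {B : {B : Set V // IsBlock G B}}
    (hv : v.1 ∈ B.1) : (blockTree G).IsBridge s(.inr B, .inl v) := by
  rw [SimpleGraph.isBridge_iff]
  rintro ⟨p⟩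
  obtain ⟨b, hb, hbv⟩ := B.2.exists_ne_mem v.2
  have hB : Sum.inr B ∈ nodesInBranch G v b :=
    B.2.isNonseparable.diff_singleton_subset_branch hb (self_mem_branch hbv)
  obtain ⟨d, -, hfst, hsnd⟩ := p.exists_boundary_dart (nodesInBranch G v b) hB notMem_branch
  have hadj := SimpleGraph.deleteEdges_adj.1 d.adj
  obtain ⟨h₁, h₂⟩ := eq_of_adj_of_mem_nodesInBranch hv hb hadj.1 hfst hsnd
  exact hadj.2 (by rw [h₁, h₂]; rfl)

theorem isAcyclic_blockTree : (blockTree G).IsAcyclic := by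
  rw [SimpleGraph.isAcyclic_iff_forall_adj_isBridge]
  rintro (v | B) (v' | B') h
  · exact h.elim
  · exact Sym2.eq_swap ▸ isBridge_blockTree h
  · exact isBridge_blockTree h
  · exact h.elim

theorem reachable_blockTree_of_mem_of_mem {B B' : {B : Set V // IsBlock G B}} (h : v ∈ B.1)
    (h' : v ∈ B'.1) : (blockTree G).Reachable (.inr B) (.inr B') := by
  by_cases hv : IsCutVertex G v
  · have hB : (blockTree G).Adj (.inr B) (.inl ⟨v, hv⟩) := h
    have hB' : (blockTree G).Adj (.inl ⟨v, hv⟩) (.inr B') := h'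
    exact hB.reachable.trans hB'.reachable
  · rw [Subtype.ext (B.2.eq_of_not_isCutVertex B'.2 hv h h')]

theorem reachable_blockTree_of_walk [Finite V] {B B' : {B : Set V // IsBlock G B}}
    (p : G.Walk a b) (ha : a ∈ B.1) (hb : b ∈ B'.1) :
    (blockTree G).Reachable (.inr B) (.inr B') := by
  induction p generalizing B with
  | nil => exact reachable_blockTree_of_mem_of_mem ha hb
  | cons h _ ih =>
    obtain ⟨D, hD, hsub⟩ := (isNonseparable_pair h).exists_isBlock
    exact (reachable_blockTree_of_mem_of_mem (B' := ⟨D, hD⟩) ha (hsub (.inl rfl))).trans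
      (ih (hsub (.inr rfl)) hb)

theorem exists_reachable_blockTree_block [Finite V] (x : Node G) :
    ∃ B, (blockTree G).Reachable x (.inr B) := by
  rcases x with v | B
  · obtain ⟨B, hB, hv⟩ := exists_isBlock_mem (G := G) v.1
    exact ⟨⟨B, hB⟩, SimpleGraph.Adj.reachable (G := blockTree G) hv⟩
  · exact ⟨B, .refl _⟩

theorem isTree_blockTree [Finite V] (hG : G.Connected) : (blockTree G).IsTree := by
  refine ⟨(SimpleGraph.connected_iff _).2 ⟨fun x y => ?_, ?_⟩, isAcyclic_blockTree⟩
  · obtain ⟨B, hB⟩ := exists_reachable_blockTree_block x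
    obtain ⟨B', hB'⟩ := exists_reachable_blockTree_block y
    obtain ⟨a, ha⟩ := B.2.nonempty
    obtain ⟨b, hb⟩ := B'.2.nonempty
    obtain ⟨p⟩ := hG.preconnected a b
    exact (hB.trans (reachable_blockTree_of_walk p ha hb)).trans hB'.symm
  · obtain ⟨v⟩ := hG.nonempty
    obtain ⟨B, hB, -⟩ := exists_isBlock_mem (G := G) v
    exact ⟨.inr ⟨B, hB⟩⟩

variable [Finite V]

open Classical in
/-- The node of the block tree to whose weight a vertex `v` of `G` contributes: `v` itself if it is
a cut vertex, and otherwise the block containing `v`. -/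
noncomputable def homeNode (G : SimpleGraph V) (v : V) : Node G :=
  if h : IsCutVertex G v then .inl ⟨v, h⟩
  else .inr ⟨(exists_isBlock_mem v).choose, (exists_isBlock_mem v).choose_spec.1⟩

theorem homeNode_eq_inl_iff {u : {v : V // IsCutVertex G v}} : homeNode G v = .inl u ↔ v = u := by
  by_cases h : IsCutVertex G v
  · simp [homeNode, h, Subtype.ext_iff]
  · simp only [homeNode, h, dite_false, reduceCtorEq, false_iff]
    rintro rfl
    exact h u.2

theorem homeNode_eq_inr_iff {B : {B : Set V // IsBlock G B}} :
    homeNode G v = .inr B ↔ v ∈ B.1 ∧ ¬ IsCutVertex G v := by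
  by_cases h : IsCutVertex G v
  · simp [homeNode, h]
  · obtain ⟨hD, hvD⟩ := (exists_isBlock_mem (G := G) v).choose_spec
    simp only [homeNode, h, dite_false, Sum.inr.injEq, Subtype.ext_iff, not_false_eq_true, and_true]
    exact ⟨fun e => e ▸ hvD, hD.eq_of_not_isCutVertex B.2 h hvD⟩

theorem ncard_homeNode_preimage_singleton (x : Node G) :
    (homeNode G ⁻¹' {x}).ncard = weight G x := by
  rcases x with u | B
  · have : homeNode G ⁻¹' {.inl u} = {u.1} := Set.ext fun _ => homeNode_eq_inl_iff
    rw [this, Set.ncard_singleton]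
    rfl
  · exact congrArg Set.ncard (Set.ext fun _ => homeNode_eq_inr_iff)

theorem setWeight_univ_weight : setWeight (weight G) Set.univ = Nat.card V := by
  have := Fintype.ofFinite V
  have := Fintype.ofFinite (Node G)
  classical
  rw [setWeight, finsum_mem_univ, finsum_eq_sum_of_fintype, Nat.card_eq_fintype_card,
    ← Finset.card_univ, Finset.card_eq_sum_card_fiberwise fun v _ => Finset.mem_univ (homeNode G v)]
  refine Finset.sum_congr rfl fun x _ => ?_
  rw [← ncard_homeNode_preimage_singleton, ← Set.ncard_coe_finset]
  congr 1
  ext v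
  simp

theorem isCutVertex_of_weight_eq_zero {B : {B : Set V // IsBlock G B}}
    (h : weight G (.inr B) = 0) (hv : v ∈ B.1) : IsCutVertex G v := by
  by_contra hcut
  exact ((Set.ncard_eq_zero).1 h).le ⟨hv, hcut⟩

theorem nontrivial_of_weight_eq_zero {B : {B : Set V // IsBlock G B}}
    (h : weight G (.inr B) = 0) : B.1.Nontrivial := by
  obtain ⟨a, ha⟩ := B.2.nonempty
  obtain ⟨b, hb, hba⟩ := B.2.exists_ne_mem (isCutVertex_of_weight_eq_zero h ha)
  exact ⟨a, ha, b, hb, hba.symm⟩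

theorem hasSparseZeros_blockTree : HasSparseZeros (blockTree G) (weight G) where
  nontrivial_neighborSet := by
    rintro (v | B) hB
    · exact absurd hB one_ne_zero
    · obtain ⟨a, ha, b, hb, hab⟩ := nontrivial_of_weight_eq_zero hB
      exact ⟨.inl ⟨a, isCutVertex_of_weight_eq_zero hB ha⟩, ha,
        .inl ⟨b, isCutVertex_of_weight_eq_zero hB hb⟩, hb, by simpa using hab⟩
  ne_zero_of_adj := by
    rintro (v | B) (v' | B') hadj h
    · exact hadj.elim
    · exact absurd h one_ne_zero
    · exact one_ne_zero
    · exact hadj.elim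

end BlockTrees

section Trichotomy

variable {V : Type*} {G : SimpleGraph V} {n : ℕ}

theorem OneCentroid.ncard_centroids (h : OneCentroid G n) :
    (centroids (blockTree G) (weight G)).ncard = 1 := by
  obtain ⟨c, hc, -⟩ := h
  rw [hc, Set.ncard_singleton]

theorem TwoCentroids.ncard_centroids (h : TwoCentroids G n) :
    (centroids (blockTree G) (weight G)).ncard = 2 := by
  obtain ⟨v, B, -, hc, -⟩ := h
  rw [hc, Set.ncard_pair Sum.inl_ne_inr]

variable [Finite V]

theorem ZeroWeightCentralBlock.two_lt_ncard_centroids (hG : G.Connected)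
    (h : ZeroWeightCentralBlock G (Nat.card V)) :
    2 < (centroids (blockTree G) (weight G)).ncard := by
  obtain ⟨B, -, -, hB, -⟩ := h
  rw [← setWeight_univ_weight (G := G)] at hB
  exact hB.two_lt_ncard_centroids (isTree_blockTree hG)

theorem twoCentroids_of_centroids_eq_pair (hG : G.Connected) {x y : Node G}
    (h : IsHalving (blockTree G) (weight G) x y)
    (hcent : centroids (blockTree G) (weight G) = {x, y}) : TwoCentroids G (Nat.card V) := by
  have hhalves {x y : Node G} (h : IsHalving (blockTree G) (weight G) x y)
      (hcent : centroids (blockTree G) (weight G) = {x, y}) :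
      EdgeHalves (blockTree G) (weight G) (Nat.card V) x y :=
    setWeight_univ_weight (G := G) ▸
      h.edgeHalves (isTree_blockTree hG) hasSparseZeros_blockTree hcent
  rcases x with v | B <;> rcases y with v' | B'
  · exact h.adj.elim
  · exact ⟨v, B', h.adj, hcent, hhalves h hcent⟩
  · rw [Set.pair_comm] at hcent
    exact ⟨v', B, h.adj, hcent, hhalves h.symm hcent⟩
  · exact h.adj.elim

theorem zeroWeightCentralBlock_of_isHalving (hG : G.Connected) {c x y : Node G} (hxy : x ≠ y)
    (hx : IsHalving (blockTree G) (weight G) c x) (hy : IsHalving (blockTree G) (weight G) c y) :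
    ZeroWeightCentralBlock G (Nat.card V) := by
  have hT := isTree_blockTree hG
  have hw := hasSparseZeros_blockTree (G := G)
  have hc : weight G c = 0 := hx.weight_eq_zero hT hy hxy notMem_branch notMem_branch
  rcases c with _ | B
  · exact absurd hc one_ne_zero
  rcases x with u | _
  swap; · exact hx.adj.elim
  rcases y with v | _
  swap; · exact hy.adj.elim
  have hB : B.1 = {u.1, v.1} := by
    refine Set.Subset.antisymm (fun z hz => ?_) (Set.pair_subset hx.adj hy.adj)
    have hz' : .inl ⟨z, isCutVertex_of_weight_eq_zero hc hz⟩ ∈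
        (blockTree G).neighborSet (.inr B) := hz
    simpa [Subtype.ext_iff] using (hx.neighborSet_eq hT hw hy hxy).le hz'
  refine ⟨B, hc, fun z => isCentralCentroid_iff_eq (hx.centroids_eq_triple hT hw hy hxy)
    hx.adj.symm hy.adj hxy id, setWeight_univ_weight (G := G) ▸ hx.vertexHalves hT hw hy hxy, ?_⟩
  have huv : u.1 ≠ v.1 := fun h => hxy (congrArg Sum.inl (Subtype.ext h))
  rw [hB]
  exact nonempty_iso_of_isBlock_pair huv (hB ▸ B.2)

theorem oneCentroid_or_twoCentroids_or_zeroWeightCentralBlock (hG : G.Connected) :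
    OneCentroid G (Nat.card V) ∨ TwoCentroids G (Nat.card V) ∨
      ZeroWeightCentralBlock G (Nat.card V) := by
  have hT := isTree_blockTree hG
  have hn := setWeight_univ_weight (G := G)
  have := hG.nonempty
  rcases exists_centroids_eq_singleton_or_exists_isHalving hT (hn ▸ Nat.card_pos) with
    ⟨c, hc, hlt⟩ | ⟨x, y, hxy⟩
  · refine .inl ⟨c, hc, ?_⟩
    rw [lt_div_iff₀' two_pos, ← hn]
    exact_mod_cast hlt
  rcases hxy.centroids_eq_pair_or_exists_isHalving hT with hcent | ⟨c, u, v, huv, hu, hv⟩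
  · exact .inr (.inl (twoCentroids_of_centroids_eq_pair hG hxy hcent))
  · exact .inr (.inr (zeroWeightCentralBlock_of_isHalving hG huv hu hv))

end Trichotomy

end BlockTree

theorem mainTheorem9 {V : Type*} [Finite V] (G : SimpleGraph V) (hG : G.Connected)
    (n : ℕ) (hn : Nat.card V = n) :
    (BlockTree.OneCentroid G n ∨ BlockTree.TwoCentroids G n ∨
      BlockTree.ZeroWeightCentralBlock G n) ∧
    ¬ (BlockTree.OneCentroid G n ∧ BlockTree.TwoCentroids G n) ∧
    ¬ (BlockTree.OneCentroid G n ∧ BlockTree.ZeroWeightCentralBlock G n) ∧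
    ¬ (BlockTree.TwoCentroids G n ∧ BlockTree.ZeroWeightCentralBlock G n) := by
  subst hn
  refine ⟨BlockTree.oneCentroid_or_twoCentroids_or_zeroWeightCentralBlock hG, ?_, ?_, ?_⟩
  · rintro ⟨h₁, h₂⟩
    have := h₁.ncard_centroids
    have := h₂.ncard_centroids
    omega
  · rintro ⟨h₁, h₃⟩
    have := h₁.ncard_centroids
    have := h₃.two_lt_ncard_centroids hG
    omega
  · rintro ⟨h₂, h₃⟩
    have := h₂.ncard_centroids
    have := h₃.two_lt_ncard_centroids hG
    omega
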